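/- Let $G$ be a totally disconnected, locally compact group and let $\alpha\colon G\to G$ be an endomorphism, that is, a continuous homomorphism. Call a subset of $G$ bounded if its closure in $G$ is compact. For $x\in G$, an $\alpha$-regressive sequence for $x$ is a sequence $(x_n)_{n\ge 0}$ in $G$ with $x_0=x$ and $\alpha(x_{n+1})=x_n$ for all $n\ge 0$. Define \[ P_\alpha=\{x\in G : \{\alpha^n(x) : n\ge 0\}\text{ is bounded}\}, \] \[ P_\alpha^{-}=\{x\in G : \text{there is an }\alpha\text{-regressive sequence }(x_n)_{n\ge 0}\text{ for }x\text{ such that }\{x_n : n\ge 0\}\text{ is bounded}\}, \] \[ M_\alpha=P_\alpha\cap P_\alpha^{-} \] (the parabolic, anti-parabolic and Levi subgroups of $\alpha$). Then each of $P_\alpha$, $P_\alpha^{-}$ and $M_\alpha$ is a closed subgroup of $G$ and is $\alpha$-invariant, that is, $\alpha(H)\subseteq H$ for $H\in\{P_\alpha,P_\alpha^{-},M_\alpha\}$. -/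

import Mathlib

/-- A subset of a topological space is bounded when it has compact closure. -/
def HasCompactClosure {G : Type*} [TopologicalSpace G] (S : Set G) : Prop :=
  IsCompact (closure S)

/-- `u` is an `α`-regressive sequence for `x`: `u 0 = x` and `α (u (n + 1)) = u n` for all `n`. -/
def IsRegressiveSeq {G : Type*} (α : G → G) (x : G) (u : ℕ → G) : Prop :=
  u 0 = x ∧ ∀ n : ℕ, α (u (n + 1)) = u n

/-- The parabolic subset of `α`: the points with bounded forward orbit. -/
def parabolic {G : Type*} [TopologicalSpace G] (α : G → G) : Set G :=
  {x | HasCompactClosure (Set.range fun n : ℕ => α^[n] x)}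

/-- The anti-parabolic subset of `α`: the points with a bounded `α`-regressive sequence. -/
def antiParabolic {G : Type*} [TopologicalSpace G] (α : G → G) : Set G :=
  {x | ∃ u : ℕ → G, IsRegressiveSeq α x u ∧ HasCompactClosure (Set.range u)}

/-- The Levi subset of `α`: the intersection of the parabolic and anti-parabolic subsets. -/
def levi {G : Type*} [TopologicalSpace G] (α : G → G) : Set G :=
  parabolic α ∩ antiParabolic α

/-- The set `S` is (the underlying set of) a closed subgroup `H` of `G` with `α(H) ⊆ H`. -/
def IsClosedInvariantSubgroup {G : Type*} [Group G] [TopologicalSpace G] (α : G → G)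
    (S : Set G) : Prop :=
  ∃ H : Subgroup G, (H : Set G) = S ∧ IsClosed (H : Set G) ∧ ∀ x ∈ H, α x ∈ H

open Topology Pointwise

/-! ### Compact open subgroups and local criteria -/

section Topology

variable {G : Type*} [Group G] [TopologicalSpace G] [IsTopologicalGroup G]

/-! The subgroup and invariance claims are formal; closedness is the point. A subgroup is closed
once its trace on an open subgroup `V` is, and this follows when all bounded orbits through `V` lie
in one compact set (`exists_openSubgroup_uniform_bound`). Fix a compact open subgroup `U`.
Bi-infinite orbits lying in `U` near both ends are uniformly bounded
(`IsHomoclinic.exists_isCompact`), and elements of a small `V` split into a factor with past in `U`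
and a factor with future in `U` (`exists_openSubgroup_factorization`). A bounded orbit with one half
in `U` returns to a coset of `V`; factoring the quotient of two visits produces a homoclinic orbit,
which bounds the other half. The factorization reduces the general case to this one. -/

theorem t2Space_of_totallyDisconnectedSpace [TotallyDisconnectedSpace G] : T2Space G := by
  have : T1Space G := ⟨fun x => by
    rw [← connectedComponent_eq_singleton x]
    exact isClosed_connectedComponent⟩
  infer_instance

/-- van Dantzig's theorem. -/
theorem exists_isCompact_openSubgroup [LocallyCompactSpace G] [TotallyDisconnectedSpace G] :
    ∃ U : OpenSubgroup G, IsCompact (U : Set G) := by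
  have := t2Space_of_totallyDisconnectedSpace (G := G)
  obtain ⟨K, hK, h1K⟩ := exists_compact_mem_nhds (1 : G)
  obtain ⟨W, hW, h1W, hWK⟩ :=
    (loc_compact_Haus_tot_disc_of_zero_dim (H := G)).mem_nhds_iff.1 h1K
  have hWc : IsCompact W := hK.of_isClosed_subset hW.1 hWK
  obtain ⟨T, hT, hTW⟩ := compact_open_separated_mul_left hWc hW.2 subset_rfl
  -- The stabiliser of `W` under left translation; it lies in `W` because `1 ∈ W`.
  let H : Subgroup G :=
    { carrier := {g | (∀ w ∈ W, g * w ∈ W) ∧ ∀ w ∈ W, g⁻¹ * w ∈ W}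
      mul_mem' := fun {a b} ha hb =>
        ⟨fun w hw => by rw [mul_assoc]; exact ha.1 _ (hb.1 _ hw),
          fun w hw => by rw [mul_inv_rev, mul_assoc]; exact hb.2 _ (ha.2 _ hw)⟩
      one_mem' := by simp
      inv_mem' := fun {a} ha => ⟨ha.2, by simpa using ha.1⟩ }
  have hH : IsOpen (H : Set G) := by
    refine H.isOpen_of_mem_nhds (g := 1) ?_
    filter_upwards [hT, inv_mem_nhds_one G hT] with g hg hg'
    exact ⟨fun w hw => hTW (Set.mul_mem_mul hg hw), fun w hw => hTW (Set.mul_mem_mul hg' hw)⟩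
  refine ⟨⟨H, hH⟩, hWc.of_isClosed_subset (H.isClosed_of_isOpen hH) fun g hg => ?_⟩
  simpa using hg.1 1 h1W

/-- A limit point of `H` can be translated into `V` by a nearby element of `H`, and since `V` is
open it is then a limit point of `H ∩ V`. -/
theorem isClosed_of_isClosed_inter_openSubgroup (H : Subgroup G) (V : OpenSubgroup G)
    (h : IsClosed ((H : Set G) ∩ V)) : IsClosed (H : Set G) := by
  refine isClosed_of_closure_subset fun x hx => ?_
  have hxV : IsOpen ((x⁻¹ * ·) ⁻¹' (V : Set G)) := V.isOpen.preimage (continuous_const_mul _)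
  obtain ⟨g, hgV, hgH⟩ := mem_closure_iff.1 hx _ hxV (by simp [one_mem])
  have hxg : x⁻¹ * g ∈ V := hgV
  have h1 : g⁻¹ * x ∈ V := by simpa using inv_mem hxg
  have h2 : g⁻¹ * x ∈ closure (H : Set G) :=
    H.topologicalClosure.mul_mem (subset_closure (H.inv_mem hgH)) hx
  have h3 : g⁻¹ * x ∈ closure ((H : Set G) ∩ V) := by
    rw [Set.inter_comm]
    exact V.isOpen.inter_closure ⟨h1, h2⟩
  rw [h.closure_eq] at h3
  simpa using H.mul_mem hgH h3.1

/-- A bounded sequence returns infinitely often to some coset of an open subgroup. -/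
theorem exists_frequently_inv_mul_mem (V : OpenSubgroup G) {K : Set G} (hK : IsCompact K)
    {s : ℕ → G} (hs : ∀ n, s n ∈ K) : ∃ p, ∀ N, ∃ q ≥ N, (s p)⁻¹ * s q ∈ V := by
  obtain ⟨c, -, hc⟩ := hK.exists_mapClusterPt (f := Filter.atTop) (u := s)
    (Filter.tendsto_principal.2 (Filter.Eventually.of_forall hs))
  have hcV : (c⁻¹ * ·) ⁻¹' (V : Set G) ∈ 𝓝 c :=
    (V.isOpen.preimage (continuous_const_mul _)).mem_nhds (by simp [one_mem])
  have hfr := hc.frequently hcV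
  obtain ⟨p, hp⟩ := hfr.exists
  refine ⟨p, fun N => ?_⟩
  obtain ⟨q, hq, hqV⟩ := Filter.frequently_atTop.1 hfr N
  refine ⟨q, hq, ?_⟩
  have hp' : c⁻¹ * s p ∈ V := hp
  have hq' : c⁻¹ * s q ∈ V := hqV
  simpa [mul_assoc] using mul_mem (inv_mem hp') hq'

theorem IsCompact.finite_image_quotientMk (U : OpenSubgroup G) {K : Set G} (hK : IsCompact K) :
    ((QuotientGroup.mk : G → G ⧸ (U : Subgroup G)) '' K).Finite :=
  (hK.image QuotientGroup.continuous_mk).finite_of_discrete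

end Topology

/-! ### Bi-infinite orbits -/

section Orbit

variable {G : Type*} [Group G]

/-- `f` is a bi-infinite orbit of `α`. -/
def IsOrbit (α : G →* G) (f : ℤ → G) : Prop :=
  ∀ n, α (f n) = f (n + 1)

namespace IsOrbit

variable {α : G →* G} {f g : ℤ → G}

theorem mul (hf : IsOrbit α f) (hg : IsOrbit α g) : IsOrbit α fun n => f n * g n :=
  fun n => by rw [map_mul, hf, hg]

theorem inv (hf : IsOrbit α f) : IsOrbit α fun n => (f n)⁻¹ :=
  fun n => by rw [map_inv, hf]

theorem shift (hf : IsOrbit α f) (k : ℤ) : IsOrbit α fun n => f (k + n) :=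
  fun n => by rw [hf, add_assoc]

theorem iterate (hf : IsOrbit α f) (k : ℤ) (n : ℕ) : α^[n] (f k) = f (k + n) := by
  induction n with
  | zero => simp
  | succ n ih => rw [Function.iterate_succ_apply', ih, hf]; push_cast; ring_nf

end IsOrbit

theorem exists_isOrbit_of_regressive (α : G →* G) {u : ℕ → G} (hu : ∀ n, α (u (n + 1)) = u n) :
    ∃ f, IsOrbit α f ∧ ∀ n : ℕ, f (-n) = u n := by
  -- As `toNat` truncates, this is `α^[n] (u 0)` for `n ≥ 0` and `u (-n)` for `n ≤ 0`.
  let f : ℤ → G := fun n => α^[n.toNat] (u (-n).toNat)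
  refine ⟨f, fun n => ?_, fun n => by simp [f]⟩
  rcases lt_or_ge n 0 with hn | hn
  · have h1 : (-n).toNat = (-(n + 1)).toNat + 1 := by omega
    have h2 : n.toNat = 0 := by omega
    have h3 : (n + 1).toNat = 0 := by omega
    simp [f, h1, h2, h3, hu]
  · have h1 : (-n).toNat = 0 := by omega
    have h2 : (-(n + 1)).toNat = 0 := by omega
    have h3 : (n + 1).toNat = n.toNat + 1 := by omega
    simp only [f, h1, h2, h3, Function.iterate_succ_apply']

theorem iterate_regressive (α : G →* G) {u : ℕ → G} (hu : ∀ n, α (u (n + 1)) = u n) (n k : ℕ) :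
    α^[n] (u (k + n)) = u k := by
  induction n with
  | zero => rfl
  | succ n ih => rw [Function.iterate_succ_apply, ← add_assoc, hu, ih]

end Orbit

/-! ### Homoclinic orbits -/

section Endomorphism

variable {G : Type*} [Group G] [TopologicalSpace G]

theorem isClosed_setOf_regressive [T2Space G] {α : G →* G} (hα : Continuous α) :
    IsClosed {u : ℕ → G | ∀ n, α (u (n + 1)) = u n} := by
  rw [Set.ofPred_forall]
  exact isClosed_iInter fun n =>
    isClosed_eq (hα.comp (continuous_apply _)) (continuous_apply _)

/-- `f` is a bi-infinite orbit of `α` that stays in `U` near `-∞` and near `∞`. -/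
structure IsHomoclinic (α : G →* G) (U : OpenSubgroup G) (f : ℤ → G) : Prop where
  isOrbit : IsOrbit α f
  past : ∃ N, ∀ n ≤ N, f n ∈ U
  future : ∃ N, ∀ n ≥ N, f n ∈ U

namespace IsHomoclinic

variable {α : G →* G} {U : OpenSubgroup G} {f g : ℤ → G}

theorem mul (hf : IsHomoclinic α U f) (hg : IsHomoclinic α U g) :
    IsHomoclinic α U fun n => f n * g n := by
  obtain ⟨a, ha⟩ := hf.past
  obtain ⟨b, hb⟩ := hg.past
  obtain ⟨c, hc⟩ := hf.future
  obtain ⟨d, hd⟩ := hg.future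
  exact ⟨hf.isOrbit.mul hg.isOrbit,
    ⟨min a b, fun n hn => mul_mem (ha n (by omega)) (hb n (by omega))⟩,
    ⟨max c d, fun n hn => mul_mem (hc n (by omega)) (hd n (by omega))⟩⟩

theorem inv (hf : IsHomoclinic α U f) : IsHomoclinic α U fun n => (f n)⁻¹ := by
  obtain ⟨a, ha⟩ := hf.past
  obtain ⟨c, hc⟩ := hf.future
  exact ⟨hf.isOrbit.inv, ⟨a, fun n hn => inv_mem (ha n hn)⟩, ⟨c, fun n hn => inv_mem (hc n hn)⟩⟩

theorem shift (hf : IsHomoclinic α U f) (k : ℤ) : IsHomoclinic α U fun n => f (k + n) := by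
  obtain ⟨a, ha⟩ := hf.past
  obtain ⟨c, hc⟩ := hf.future
  exact ⟨hf.isOrbit.shift k, ⟨a - k, fun n hn => ha _ (by omega)⟩,
    ⟨c - k, fun n hn => hc _ (by omega)⟩⟩

variable [IsTopologicalGroup G]

/-- The homoclinic orbits are uniformly bounded. -/
theorem exists_isCompact (hα : Continuous α) (hU : IsCompact (U : Set G)) :
    ∃ C : Set G, IsCompact C ∧ ∀ f, IsHomoclinic α U f → ∀ n, f n ∈ C := by
  -- For `f` in `F`, `f 0` lies in the compact set `α(U)`, hence in one of finitely many cosets of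
  -- `U`.
  let F : Set (ℤ → G) := {f | IsHomoclinic α U f ∧ ∀ n < 0, f n ∈ U}
  let mk : G → G ⧸ (U : Subgroup G) := QuotientGroup.mk
  let Q : Set (G ⧸ (U : Subgroup G)) := (fun f : ℤ → G => mk (f 0)) '' F
  have hQ : Q.Finite := by
    refine ((hU.image hα).finite_image_quotientMk U).subset ?_
    rintro _ ⟨f, hf, rfl⟩
    refine ⟨f 0, ⟨f (-1), hf.2 _ (by norm_num), ?_⟩, rfl⟩
    rw [hf.1.isOrbit]; norm_num
  have hr : ∀ q : G ⧸ (U : Subgroup G), ∃ f : ℤ → G, q ∈ Q → f ∈ F ∧ mk (f 0) = q := fun q => by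
    by_cases hq : q ∈ Q
    · obtain ⟨f, hf, h⟩ := hq
      exact ⟨f, fun _ => ⟨hf, h⟩⟩
    · exact ⟨1, fun h => absurd h hq⟩
  choose r hr using hr
  obtain ⟨N, hN⟩ : ∃ N : ℕ, ∀ q ∈ Q, ∀ n : ℤ, N ≤ n → r q n ∈ U := by
    have : ∀ᶠ N : ℕ in Filter.atTop, ∀ q ∈ Q, ∀ n : ℤ, N ≤ n → r q n ∈ U := by
      refine (Filter.eventually_all_finite hQ).2 fun q hq => ?_
      obtain ⟨M, hM⟩ := (hr q hq).1.1.future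
      filter_upwards [Filter.eventually_ge_atTop M.toNat] with N hN n hn
      exact hM n (by omega)
    exact this.exists
  let D : ℕ → Set G := fun k =>
    {x | ∃ f, IsHomoclinic α U f ∧ (∀ n : ℤ, n ≤ -k → f n ∈ U) ∧ f 0 = x}
  have hD0 : D 0 ⊆ U := by
    rintro _ ⟨f, -, hf, rfl⟩
    exact hf 0 (by simp)
  -- Dividing by a shifted representative of the coset at time `-k` delays the first exit from `U`
  -- by one step.
  have hD : ∀ k, D (k + 1) ⊆ ((fun q => r q k) '' Q) * D k := by
    rintro k _ ⟨f, hf, h, rfl⟩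
    have hq : mk (f (-k)) ∈ Q := by
      refine ⟨_, ⟨hf.shift (-k), fun n hn => h _ (by push_cast; omega)⟩, ?_⟩
      simp
    obtain ⟨⟨h1, h2⟩, h3⟩ := hr _ hq
    set g := r (mk (f (-k)))
    refine ⟨g k, ⟨_, hq, rfl⟩, (g k)⁻¹ * f 0, ⟨fun n => (g (k + n))⁻¹ * f n, ?_, ?_, by simp⟩,
      by simp⟩
    · exact (h1.shift k).inv.mul hf
    · intro n hn
      rcases hn.eq_or_lt with rfl | hn
      · beta_reduce
        rw [add_neg_cancel]
        exact QuotientGroup.eq.1 h3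
      · exact mul_mem (inv_mem (h2 _ (by omega))) (h _ (by push_cast; omega))
  have hDc : ∀ k, ∃ K, IsCompact K ∧ D k ⊆ K := fun k => by
    induction k with
    | zero => exact ⟨U, hU, hD0⟩
    | succ k ih =>
      obtain ⟨K, hK, hDK⟩ := ih
      exact ⟨_, (hQ.image _).isCompact.mul hK, (hD k).trans (Set.mul_subset_mul_left hDK)⟩
  obtain ⟨K, hK, hDK⟩ := hDc N
  -- From time `N` on the representatives lie in `U`, so further factors are absorbed by `U`.
  have hDN : ∀ k, D (N + k) ⊆ (U : Set G) * K := fun k => by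
    induction k with
    | zero => exact fun x hx => ⟨1, one_mem U, x, hDK hx, one_mul x⟩
    | succ k ih =>
      intro x hx
      obtain ⟨_, ⟨q, hq, rfl⟩, y, hy, rfl⟩ := hD _ hx
      obtain ⟨a, ha, b, hb, rfl⟩ := ih hy
      exact ⟨_, mul_mem (hN q hq _ (by exact_mod_cast N.le_add_right k)) ha, b, hb, mul_assoc _ _ _⟩
  refine ⟨(U : Set G) * K, hU.mul hK, fun f hf n => ?_⟩
  obtain ⟨M, hM⟩ := (hf.shift n).past
  exact hDN (-M).toNat ⟨_, hf.shift n, fun i hi => hM i (by push_cast at hi; omega), by simp⟩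

end IsHomoclinic

/-! ### Parabolic and anti-parabolic subgroups -/

variable [IsTopologicalGroup G] {α : G →* G} {U : OpenSubgroup G}

theorem hasCompactClosure_range_iff {u : ℕ → G} :
    HasCompactClosure (Set.range u) ↔ ∃ K, IsCompact K ∧ ∀ n, u n ∈ K :=
  ⟨fun h => ⟨_, h, fun n => subset_closure ⟨n, rfl⟩⟩, fun ⟨_, hK, hu⟩ =>
    hK.closure_of_subset (Set.range_subset_iff.2 hu)⟩

theorem mem_parabolic_iff {x : G} :
    x ∈ parabolic α ↔ ∃ K, IsCompact K ∧ ∀ n : ℕ, α^[n] x ∈ K :=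
  hasCompactClosure_range_iff

theorem mem_antiParabolic_iff {x : G} :
    x ∈ antiParabolic α ↔
      ∃ u : ℕ → G, IsRegressiveSeq α x u ∧ ∃ K, IsCompact K ∧ ∀ n, u n ∈ K :=
  exists_congr fun _ => and_congr_right fun _ => hasCompactClosure_range_iff

/-- The parabolic subgroup of an endomorphism. -/
def parabolicSubgroup (α : G →* G) : Subgroup G where
  carrier := parabolic α
  mul_mem' {a b} ha hb := by
    obtain ⟨K, hK, haK⟩ := mem_parabolic_iff.1 ha
    obtain ⟨L, hL, hbL⟩ := mem_parabolic_iff.1 hb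
    exact mem_parabolic_iff.2 ⟨K * L, hK.mul hL, fun n => by
      rw [iterate_map_mul]; exact Set.mul_mem_mul (haK n) (hbL n)⟩
  one_mem' := mem_parabolic_iff.2 ⟨{1}, isCompact_singleton, fun n => iterate_map_one α n⟩
  inv_mem' {a} ha := by
    obtain ⟨K, hK, haK⟩ := mem_parabolic_iff.1 ha
    exact mem_parabolic_iff.2 ⟨K⁻¹, hK.inv, fun n => by
      rw [iterate_map_inv]; exact Set.inv_mem_inv.2 (haK n)⟩

/-- The anti-parabolic subgroup of an endomorphism. -/
def antiParabolicSubgroup (α : G →* G) : Subgroup G where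
  carrier := antiParabolic α
  mul_mem' {a b} ha hb := by
    obtain ⟨u, ⟨hu0, hu⟩, K, hK, huK⟩ := mem_antiParabolic_iff.1 ha
    obtain ⟨v, ⟨hv0, hv⟩, L, hL, hvL⟩ := mem_antiParabolic_iff.1 hb
    exact mem_antiParabolic_iff.2 ⟨u * v, ⟨by simp [hu0, hv0], fun n => by simp [hu, hv]⟩,
      K * L, hK.mul hL, fun n => Set.mul_mem_mul (huK n) (hvL n)⟩
  one_mem' := mem_antiParabolic_iff.2
    ⟨1, ⟨rfl, fun _ => map_one α⟩, {1}, isCompact_singleton, fun _ => rfl⟩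
  inv_mem' {a} ha := by
    obtain ⟨u, ⟨hu0, hu⟩, K, hK, huK⟩ := mem_antiParabolic_iff.1 ha
    exact mem_antiParabolic_iff.2 ⟨u⁻¹, ⟨by simp [hu0], fun n => by simp [hu]⟩,
      K⁻¹, hK.inv, fun n => Set.inv_mem_inv.2 (huK n)⟩

theorem map_mem_parabolicSubgroup {x : G} (hx : x ∈ parabolicSubgroup α) :
    α x ∈ parabolicSubgroup α := by
  obtain ⟨K, hK, hxK⟩ := mem_parabolic_iff.1 hx
  exact mem_parabolic_iff.2 ⟨K, hK, fun n => by
    rw [← Function.iterate_succ_apply]; exact hxK (n + 1)⟩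

theorem map_mem_antiParabolicSubgroup {x : G} (hx : x ∈ antiParabolicSubgroup α) :
    α x ∈ antiParabolicSubgroup α := by
  obtain ⟨u, ⟨rfl, hu⟩, K, hK, huK⟩ := mem_antiParabolic_iff.1 hx
  refine mem_antiParabolic_iff.2 ⟨fun n => α (u n), ⟨rfl, fun n => congrArg α (hu n)⟩, insert (α (u 0)) K,
    hK.insert _, fun n => ?_⟩
  cases n with
  | zero => exact Set.mem_insert _ _
  | succ n => exact Set.mem_insert_of_mem _ (by simpa only [hu] using huK n)

/-! ### Factorization and uniform bounds -/

variable [T2Space G]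

/-- The cosets of `α (z 0)`, for chains `z` of length `k` in `U`, form finite sets decreasing in
`k`, hence stable from some `N` on. The orbit of `x` read backwards is a chain of length `N`, so its
coset is reached by arbitrarily long chains and, by compactness, by an infinite one. -/
theorem exists_regressive_inv_mul_iterate_mem (hα : Continuous α) (hU : IsCompact (U : Set G)) :
    ∃ N : ℕ, ∀ x, (∀ i ≤ N, α^[i] x ∈ U) → ∃ u : ℕ → G,
      ((∀ n, u n ∈ U) ∧ ∀ n, α (u (n + 1)) = u n) ∧ (α (u 0))⁻¹ * α^[N + 1] x ∈ U := by
  let mk : G → G ⧸ (U : Subgroup G) := QuotientGroup.mk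
  let S : ℕ → Set (ℕ → G) := fun k => {z | (∀ i, z i ∈ U) ∧ ∀ i < k, α (z (i + 1)) = z i}
  let D : ℕ → Set (G ⧸ (U : Subgroup G)) := fun k => (fun z : ℕ → G => mk (α (z 0))) '' S k
  have hSanti : Antitone S := fun a b hab z hz => ⟨hz.1, fun i hi => hz.2 i (by omega)⟩
  have hDanti : Antitone D := fun a b hab => Set.image_mono (hSanti hab)
  have hD0 : (D 0).Finite := by
    refine ((hU.image hα).finite_image_quotientMk U).subset ?_
    rintro _ ⟨z, hz, rfl⟩
    exact ⟨_, ⟨z 0, hz.1 0, rfl⟩, rfl⟩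
  obtain ⟨N, hN⟩ : ∃ N, ∀ q ∈ D 0, q ∈ D N → ∀ k, q ∈ D k := by
    have : ∀ᶠ N in Filter.atTop, ∀ q ∈ D 0, q ∈ D N → ∀ k, q ∈ D k := by
      refine (Filter.eventually_all_finite hD0).2 fun q _ => ?_
      by_cases h : ∀ k, q ∈ D k
      · exact Filter.Eventually.of_forall fun _ _ => h
      · push Not at h
        obtain ⟨k, hk⟩ := h
        filter_upwards [Filter.eventually_ge_atTop k] with N hN hq
        exact absurd (hDanti hN hq) hk
    exact this.exists
  refine ⟨N, fun x hx => ?_⟩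
  have hq : mk (α^[N + 1] x) ∈ D N := by
    refine ⟨fun i => α^[N - i] x, ⟨fun i => hx _ (by omega), fun i hi => ?_⟩, ?_⟩
    · have : N - i = N - (i + 1) + 1 := by omega
      simp only [this, Function.iterate_succ_apply']
    · simp only [Nat.sub_zero, Function.iterate_succ_apply']
  have hall := hN _ (hDanti (Nat.zero_le N) hq) hq
  have hclU := U.isClosed
  have hcl : ∀ k, IsClosed (S k) := fun k => by
    have : S k = (⋂ i, {z : ℕ → G | z i ∈ (U : Set G)}) ∩
        ⋂ i, ⋂ (_ : i < k), {z | α (z (i + 1)) = z i} := by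
      ext z; simp [S]
    rw [this]
    exact (isClosed_iInter fun i => hclU.preimage (continuous_apply i)).inter
      (isClosed_iInter fun i => isClosed_iInter fun _ =>
        isClosed_eq (hα.comp (continuous_apply _)) (continuous_apply _))
  have hclT : IsClosed {z : ℕ → G | (α (z 0))⁻¹ * α^[N + 1] x ∈ (U : Set G)} :=
    hclU.preimage (((hα.comp (continuous_apply 0)).inv).mul continuous_const)
  have hS0 : IsCompact (S 0) :=
    (isCompact_univ_pi fun _ : ℕ => hU).of_isClosed_subset (hcl 0) fun z hz i _ => hz.1 i
  obtain ⟨u, hu⟩ := IsCompact.nonempty_iInter_of_sequence_nonempty_isCompact_isClosed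
    (fun k => S k ∩ {z : ℕ → G | (α (z 0))⁻¹ * α^[N + 1] x ∈ (U : Set G)})
    (fun k => Set.inter_subset_inter_left _ (hSanti k.le_succ))
    (fun k => by
      obtain ⟨z, hz, hzq⟩ := hall k
      exact ⟨z, hz, QuotientGroup.eq.1 hzq⟩)
    (hS0.inter_right hclT) (fun k => (hcl k).inter hclT)
  rw [Set.mem_iInter] at hu
  exact ⟨u, ⟨(hu 0).1.1, fun n => (hu (n + 1)).1.2 n n.lt_succ_self⟩, (hu 0).2⟩

/-- A small open subgroup `V` satisfies `V ⊆ U₊ U₋`: each of its elements is the product of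
an element with a past in `U` and an element with forward orbit in `U`. -/
theorem exists_openSubgroup_factorization (hα : Continuous α) (hU : IsCompact (U : Set G)) :
    ∃ V : OpenSubgroup G, ∀ x ∈ V, ∃ f, IsOrbit α f ∧ (∀ n ≤ 0, f n ∈ U) ∧
      ∀ n : ℕ, α^[n] ((f 0)⁻¹ * x) ∈ U := by
  obtain ⟨N, hN⟩ := exists_regressive_inv_mul_iterate_mem hα hU
  let V : OpenSubgroup G :=
    { carrier := {x | ∀ i ≤ N, α^[i] x ∈ U}
      mul_mem' := fun ha hb i hi => by
        rw [iterate_map_mul]; exact mul_mem (ha i hi) (hb i hi)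
      one_mem' := fun i _ => by rw [iterate_map_one]; exact one_mem U
      inv_mem' := fun ha i hi => by rw [iterate_map_inv]; exact inv_mem (ha i hi)
      isOpen' := by
        have : {x | ∀ i ≤ N, α^[i] x ∈ U} = ⋂ i ∈ Set.Iic N, (α^[i]) ⁻¹' (U : Set G) := by
          ext x; simp
        change IsOpen {x | ∀ i ≤ N, α^[i] x ∈ U}
        rw [this]
        exact (Set.finite_Iic N).isOpen_biInter fun i _ => U.isOpen.preimage (hα.iterate i) }
  refine ⟨V, fun x hx => ?_⟩
  have key : ∀ M, ∃ u : ℕ → G, ((∀ n, u n ∈ U) ∧ ∀ n, α (u (n + 1)) = u n) ∧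
      ∀ i ≤ N + M, α^[i] ((u 0)⁻¹ * x) ∈ U := fun M => by
    induction M with
    | zero => exact ⟨1, ⟨fun _ => one_mem U, fun _ => map_one α⟩, by simpa using (show ∀ i ≤ N, α^[i] x ∈ U from hx)⟩
    | succ M ih =>
      obtain ⟨u, ⟨huU, hu⟩, hb⟩ := ih
      obtain ⟨a, ⟨haU, ha⟩, hab⟩ := hN (α^[M] ((u 0)⁻¹ * x)) fun i hi => by
        rw [← Function.iterate_add_apply]; exact hb _ (by omega)
      rw [← Function.iterate_add_apply] at hab
      -- With this shift the new factor at `0` stays in `U` under `α^[i]` for `i ≤ N + M`, and one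
      -- step later it becomes `α (a 0)`, the required correction.
      refine ⟨fun n => u n * a (n + (N + M)), ⟨fun n => mul_mem (huU _) (haU _), fun n => ?_⟩,
        fun i hi => ?_⟩
      · rw [map_mul, hu, Nat.add_right_comm, ha]
      · rw [mul_inv_rev, mul_assoc, iterate_map_mul, iterate_map_inv, zero_add]
        rcases Nat.lt_or_ge (N + M) i with h | h
        · obtain rfl : i = N + 1 + M := by omega
          have h0 := iterate_regressive α ha (N + M) 0
          rw [zero_add] at h0
          rwa [show N + 1 + M = (N + M) + 1 by omega, Function.iterate_succ_apply' α (N + M)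
            (a (N + M)), h0, show N + M + 1 = N + 1 + M by omega]
        · have h0 := iterate_regressive α ha i (N + M - i)
          rw [Nat.sub_add_cancel h] at h0
          rw [h0]
          exact mul_mem (inv_mem (haU _)) (hb i h)
  have hclU := U.isClosed
  let T : ℕ → Set (ℕ → G) := fun M => {u | (∀ n, u n ∈ U) ∧ ∀ n, α (u (n + 1)) = u n} ∩
    {u | ∀ i ≤ N + M, α^[i] ((u 0)⁻¹ * x) ∈ U}
  have hcl : ∀ M, IsClosed (T M) := fun M => by
    have : T M = ((⋂ i, {z : ℕ → G | z i ∈ (U : Set G)}) ∩ {u | ∀ n, α (u (n + 1)) = u n}) ∩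
        ⋂ i, ⋂ (_ : i ≤ N + M), {u | α^[i] ((u 0)⁻¹ * x) ∈ (U : Set G)} := by
      ext z; simp [T]
    rw [this]
    exact ((isClosed_iInter fun i => hclU.preimage (continuous_apply i)).inter
      (isClosed_setOf_regressive hα)).inter (isClosed_iInter fun i => isClosed_iInter fun _ =>
        hclU.preimage ((hα.iterate i).comp ((continuous_apply 0).inv.mul continuous_const)))
  obtain ⟨u, hu⟩ := IsCompact.nonempty_iInter_of_sequence_nonempty_isCompact_isClosed T
    (fun M => Set.inter_subset_inter_right _ fun u hu i hi => hu i (by omega)) key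
    ((isCompact_univ_pi fun _ : ℕ => hU).of_isClosed_subset (hcl 0) fun z hz i _ => hz.1.1 i) hcl
  rw [Set.mem_iInter] at hu
  obtain ⟨f, hf, hfu⟩ := exists_isOrbit_of_regressive α (hu 0).1.2
  have hf0 : f 0 = u 0 := by simpa using hfu 0
  refine ⟨f, hf, fun n hn => ?_, fun n => ?_⟩
  · obtain ⟨k, rfl⟩ : ∃ k : ℕ, n = -k := ⟨(-n).toNat, by omega⟩
    rw [hfu]
    exact (hu 0).1.1 k
  · rw [hf0]
    exact (hu n).2 n (by omega)

/-- Uniform bounds for the bounded forward and backward orbits that start in a small open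
subgroup. -/
theorem exists_openSubgroup_uniform_bound (hα : Continuous α) (hU : IsCompact (U : Set G)) :
    ∃ (V : OpenSubgroup G) (C : Set G), IsCompact C ∧
      (∀ x ∈ V, (∃ K, IsCompact K ∧ ∀ n : ℕ, α^[n] x ∈ K) → ∀ n : ℕ, α^[n] x ∈ C) ∧
      ∀ f, IsOrbit α f → f 0 ∈ V → (∃ K, IsCompact K ∧ ∀ n : ℕ, f (-n) ∈ K) →
        ∀ n : ℕ, f (-n) ∈ C := by
  obtain ⟨V, hV⟩ := exists_openSubgroup_factorization hα hU
  obtain ⟨L, hL, hLf⟩ := IsHomoclinic.exists_isCompact (U := U) hα hU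
  have hforward : ∀ f, IsOrbit α f → (∀ n ≤ 0, f n ∈ U) →
      ∀ K, IsCompact K → (∀ n : ℕ, f n ∈ K) → ∀ m : ℕ, f m ∈ (U : Set G) * L := by
    intro f hf hfU K hK hfK m
    obtain ⟨p, hp⟩ := exists_frequently_inv_mul_mem V hK hfK
    obtain ⟨q, hq, hpq⟩ := hp (p + m)
    have hy := (hf.shift p).inv.mul (hf.shift q)
    obtain ⟨A, hA, hAU, hB⟩ := hV _ hpq
    have hBo := hA.inv.mul hy
    have hBL : IsHomoclinic α U fun n => (A n)⁻¹ * ((f (p + n))⁻¹ * f (q + n)) := by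
      refine ⟨hBo, ⟨-q, fun n hn => ?_⟩, ⟨0, fun n hn => ?_⟩⟩
      · exact mul_mem (inv_mem (hAU _ (by omega)))
          (mul_mem (inv_mem (hfU _ (by omega))) (hfU _ (by omega)))
      · lift n to ℕ using hn
        have h := hBo.iterate 0 n
        simp only [zero_add, add_zero] at h
        rw [← h]
        exact hB n
    -- Since `q ≥ p + m`, both times `p + (m - q)` and `m - q` are nonpositive.
    refine ⟨f (p + (m - q)) * A (m - q), mul_mem (hfU _ (by omega)) (hAU _ (by omega)), _,
      hLf _ hBL (m - q), ?_⟩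
    simp [mul_assoc]
  have hbackward : ∀ f, IsOrbit α f → (∀ n ≥ 0, f n ∈ U) →
      ∀ K, IsCompact K → (∀ n : ℕ, f (-n) ∈ K) → ∀ m : ℕ, f (-m) ∈ (U : Set G) * L := by
    intro f hf hfU K hK hfK m
    obtain ⟨p, hp⟩ := exists_frequently_inv_mul_mem V hK hfK
    obtain ⟨q, hq, hpq⟩ := hp (p + m)
    have hy := (hf.shift (-p)).inv.mul (hf.shift (-q))
    -- Factoring the inverse puts the homoclinic factor, now `A⁻¹`, on the right again.
    obtain ⟨A, hA, hAU, hB⟩ := hV _ (inv_mem hpq)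
    have hDo := hy.mul hA
    have hDU : ∀ n ≥ (0 : ℤ), (f (-p + n))⁻¹ * f (-q + n) * A n ∈ U := fun n hn => by
      lift n to ℕ using hn
      have h := hDo.iterate 0 n
      simp only [zero_add, add_zero] at h
      rw [← h]
      have := inv_mem (hB n)
      rwa [← iterate_map_inv, mul_inv_rev, inv_inv, inv_inv] at this
    have hAL : IsHomoclinic α U A := by
      refine ⟨hA, ⟨0, hAU⟩, ⟨q, fun n hn => ?_⟩⟩
      have h1 : (f (-p + n))⁻¹ * f (-q + n) ∈ U :=
        mul_mem (inv_mem (hfU _ (by omega))) (hfU _ (by omega))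
      have h2 := mul_mem (inv_mem h1) (hDU n (by omega))
      rwa [inv_mul_cancel_left] at h2
    refine ⟨f (-p + (q - m)) * ((f (-p + (q - m)))⁻¹ * f (-q + (q - m)) * A (q - m)),
      mul_mem (hfU _ (by omega)) (hDU _ (by omega)), _, hLf _ hAL.inv (q - m), ?_⟩
    rw [show (-m : ℤ) = -q + (q - m) by ring]
    simp [mul_assoc]
  -- The right-hand `U` absorbs the future factor of a forward orbit, the left-hand one the past
  -- factor of a backward orbit.
  refine ⟨V, (U : Set G) * ((U : Set G) * L) * U, (hU.mul (hU.mul hL)).mul hU, ?_, ?_⟩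
  · rintro x hx ⟨K, hK, hxK⟩ n
    obtain ⟨A, hA, hAU, hB⟩ := hV x hx
    have hAn : ∀ n : ℕ, A n = α^[n] x * (α^[n] ((A 0)⁻¹ * x))⁻¹ := fun n => by
      have h := hA.iterate 0 n
      rw [zero_add] at h
      rw [iterate_map_mul, iterate_map_inv, h]
      simp
    have h := hforward A hA hAU (K * U) (hK.mul hU)
      (fun n => hAn n ▸ Set.mul_mem_mul (hxK n) (inv_mem (hB n))) n
    refine ⟨A n, ⟨1, one_mem U, A n, h, one_mul _⟩, _, hB n, ?_⟩
    rw [hAn]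
    simp
  · rintro f hf hf0 ⟨K, hK, hfK⟩ n
    obtain ⟨A, hA, hAU, hB⟩ := hV _ hf0
    have hBo := hA.inv.mul hf
    have hBU : ∀ n ≥ (0 : ℤ), (A n)⁻¹ * f n ∈ U := fun n hn => by
      lift n to ℕ using hn
      have h := hBo.iterate 0 n
      rw [zero_add] at h
      rw [← h]
      exact hB n
    have h := hbackward _ hBo hBU (U * K) (hU.mul hK)
      (fun n => Set.mul_mem_mul (inv_mem (hAU _ (by omega))) (hfK n)) n
    exact ⟨_, Set.mul_mem_mul (hAU (-n) (by omega)) h, 1, one_mem U, by simp⟩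

/-! ### Closedness -/

theorem isClosed_parabolicSubgroup (hα : Continuous α) (hU : IsCompact (U : Set G)) :
    IsClosed (parabolicSubgroup α : Set G) := by
  obtain ⟨V, C, hC, hforward, -⟩ := exists_openSubgroup_uniform_bound hα hU
  refine isClosed_of_isClosed_inter_openSubgroup _ V ?_
  have : (parabolicSubgroup α : Set G) ∩ V = (⋂ n : ℕ, (α^[n]) ⁻¹' C) ∩ V := by
    refine Set.ext fun x => and_congr_left fun hx => ?_
    rw [Set.mem_iInter]
    exact ⟨fun h => hforward x hx (mem_parabolic_iff.1 h),
      fun h => mem_parabolic_iff.2 ⟨C, hC, h⟩⟩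
  rw [this]
  exact (isClosed_iInter fun n => hC.isClosed.preimage (hα.iterate n)).inter V.isClosed

theorem isClosed_antiParabolicSubgroup (hα : Continuous α) (hU : IsCompact (U : Set G)) :
    IsClosed (antiParabolicSubgroup α : Set G) := by
  obtain ⟨V, C, hC, -, hbackward⟩ := exists_openSubgroup_uniform_bound hα hU
  refine isClosed_of_isClosed_inter_openSubgroup _ V ?_
  have hS := (isCompact_univ_pi fun _ : ℕ => hC).inter_right (isClosed_setOf_regressive hα)
  -- Within `V` the subgroup is the projection of the compact set of regressive sequences in `C`.
  have : (antiParabolicSubgroup α : Set G) ∩ V = ((fun u : ℕ → G => u 0) ''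
      (Set.pi Set.univ (fun _ : ℕ => C) ∩ {u | ∀ n, α (u (n + 1)) = u n})) ∩ V := by
    refine Set.ext fun x => and_congr_left fun hx => ⟨fun h => ?_, ?_⟩
    · obtain ⟨u, ⟨rfl, hu⟩, K, hK, huK⟩ := mem_antiParabolic_iff.1 h
      obtain ⟨f, hf, hfu⟩ := exists_isOrbit_of_regressive α hu
      have hf0 : f 0 = u 0 := by simpa using hfu 0
      refine ⟨u, ⟨fun n _ => ?_, hu⟩, rfl⟩
      rw [← hfu]
      exact hbackward f hf (hf0 ▸ hx) ⟨K, hK, fun n => hfu n ▸ huK n⟩ n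
    · rintro ⟨u, ⟨huC, hu⟩, rfl⟩
      exact mem_antiParabolic_iff.2 ⟨u, ⟨rfl, hu⟩, C, hC, fun n => huC n trivial⟩
  rw [this]
  exact (hS.image (continuous_apply 0)).isClosed.inter V.isClosed

end Endomorphism

theorem mainTheorem8 {G : Type*} [Group G] [TopologicalSpace G] [IsTopologicalGroup G]
    [LocallyCompactSpace G] [TotallyDisconnectedSpace G] (α : G →ₜ* G) :
    IsClosedInvariantSubgroup α (parabolic α) ∧
      IsClosedInvariantSubgroup α (antiParabolic α) ∧
      IsClosedInvariantSubgroup α (levi α) := by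
  have := t2Space_of_totallyDisconnectedSpace (G := G)
  obtain ⟨U, hU⟩ := exists_isCompact_openSubgroup (G := G)
  have hα : Continuous (α : G →* G) := α.continuous_toFun
  have hP := isClosed_parabolicSubgroup hα hU
  have hA := isClosed_antiParabolicSubgroup hα hU
  exact ⟨⟨parabolicSubgroup α, rfl, hP, fun _ => map_mem_parabolicSubgroup⟩,
    ⟨antiParabolicSubgroup α, rfl, hA, fun _ => map_mem_antiParabolicSubgroup⟩,
    ⟨parabolicSubgroup α ⊓ antiParabolicSubgroup α, rfl, hP.inter hA, fun _ hx =>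
      ⟨map_mem_parabolicSubgroup hx.1, map_mem_antiParabolicSubgroup hx.2⟩⟩⟩
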